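/- Let $X$ be a reflexive real normed space with continuous dual $X^*$, and let $f:X\to\mathbb R\cup\{+\infty\}$ be proper (finite at some point) and lower semicontinuous. Let $\bar x\in X$ and $\delta\in(0,+\infty)$ be such that $f(\bar x)<f(x)$ for all $x\in\mathbb B(\bar x,\delta)\setminus\{\bar x\}$, where $\mathbb B(\bar x,\delta)$ is the closed ball. Let $p,q\in(1,+\infty)$ with $\frac1p+\frac1q=1$. Then the following statements are equivalent. (i) (Growth condition) There exists $\gamma>0$ such that $f(x)\ge f(\bar x)+\gamma\|x-\bar x\|^p$ for all $x\in\mathbb B(\bar x,\delta)$. (ii) (Tilt sub-stability) There exists $\kappa>0$ such that, for every $\xi\in X^*$ and every $x\in\operatorname{argmin}_{y\in\mathbb B(\bar x,\delta)}\{f(y)-\langle\xi,y\rangle\}$, one has $\|x-\bar x\|\le\kappa\|\xi\|^{q/p}$. (iii) (Łojasiewicz-type inequality) There exists $\mu>0$ such that, for every $\xi\in X^*$ and every $x\in\operatorname{argmin}_{y\in\mathbb B(\bar x,\delta)}\{f(y)-\langle\xi,y\rangle\}$, one has $f(x)-f(\bar x)\le\mu\|\xi\|^q$. Moreover, the constants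 are related as follows: if (i) holds with $\gamma>0$, then (ii) holds with $\kappa=\gamma^{-q/p}$; if (ii) holds with $\kappa>0$, then (iii) holds with $\mu=\kappa$; if (iii) holds with $\mu>0$, then (i) holds with $\gamma=p^{-p}\mu^{-p/q}$. -/

import Mathlib

namespace TiltGrowth

variable {X : Type*} [NormedAddCommGroup X] [NormedSpace ℝ X]

/-- A real normed space is reflexive if the canonical map into its bidual is onto. -/
def IsReflexive (X : Type*) [NormedAddCommGroup X] [NormedSpace ℝ X] : Prop :=
  Function.Surjective (NormedSpace.inclusionInDoubleDual ℝ X)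

/-- A function with values in `ℝ ∪ {+∞}` that is finite at some point. -/
def IsProper (f : X → EReal) : Prop :=
  (∀ x, f x ≠ ⊥) ∧ ∃ x, f x ≠ ⊤

/-- The set of minimizers of `g` over `S`. -/
def argminOn (S : Set X) (g : X → EReal) : Set X :=
  {x | x ∈ S ∧ ∀ y ∈ S, g x ≤ g y}

/-- The linearly perturbed (tilted) function `f - ⟨ξ, ·⟩`. -/
noncomputable def tilt (f : X → EReal) (ξ : StrongDual ℝ X) : X → EReal :=
  fun y => f y - ((ξ y : ℝ) : EReal)

/-- `f x ≥ f x₀ + γ ‖x - x₀‖ ^ p` on the closed ball. -/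
def GrowthCondition (f : X → EReal) (x₀ : X) (δ p γ : ℝ) : Prop :=
  ∀ x ∈ Metric.closedBall x₀ δ,
    f x₀ + ((γ * ‖x - x₀‖ ^ p : ℝ) : EReal) ≤ f x

/-- Every minimizer over the closed ball of every tilt satisfies
`‖x - x₀‖ ≤ κ ‖ξ‖ ^ (q / p)`. -/
def TiltSubstable (f : X → EReal) (x₀ : X) (δ p q κ : ℝ) : Prop :=
  ∀ ξ : StrongDual ℝ X, ∀ x ∈ argminOn (Metric.closedBall x₀ δ) (tilt f ξ),
    ‖x - x₀‖ ≤ κ * ‖ξ‖ ^ (q / p)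

/-- Every minimizer over the closed ball of every tilt satisfies
`f x - f x₀ ≤ μ ‖ξ‖ ^ q`. -/
def LojasiewiczBound (f : X → EReal) (x₀ : X) (δ q μ : ℝ) : Prop :=
  ∀ ξ : StrongDual ℝ X, ∀ x ∈ argminOn (Metric.closedBall x₀ δ) (tilt f ξ),
    f x - f x₀ ≤ ((μ * ‖ξ‖ ^ q : ℝ) : EReal)

end TiltGrowth

/-! Comparing a minimizer x of a tilt with x₀ gives f x - f x₀ ≤ ‖ξ‖ ‖x - x₀‖, and the implications
(i) → (ii) → (iii) are then algebra with exponents. The substance is (iii) → (i), proved on the dual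
side.

Let g = f - f x₀ on the part of the ball where f is finite, and let F be its conjugate with origin
x₀: convex, δ-Lipschitz, nonnegative, F 0 = 0. The dual is reflexive, so F is Fréchet smooth on a
dense set (Asplund property), and at smooth points maximizing sequences converge in norm, so the
tilt has a minimizer x (`exists_conjOn_le`). Testing F (s • ξ) with this x turns (iii) into a
discrete form of F - t F' ≤ μ ‖ξ‖^q along rays (`conjOn_smul_ge`). Integration
(`div_le_of_forall_smul_ge`) bounds F (t • ξ) / t by σ ξ plus a multiple of t^(q-1), where σ is the
directional derivative at 0.

The strict minimum forces σ = 0 (`dirDerivZero_conjOn_eq_zero`): at smooth points of σ,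
near-maximizers for t • ξ converge as t → 0, necessarily to x₀. Hence F ξ ≤ μ / (q-1) ‖ξ‖^q, and the
Fenchel-Young inequality returns the growth of f with the stated constant. -/

namespace TiltGrowth

open Filter Topology Metric

/-! ### Generic smoothness of convex functions on reflexive spaces -/

/-- A closed subspace is cut out by the continuous functionals vanishing on it. -/
theorem exists_dual_eq_zero_of_notMem {Y : Type*} [NormedAddCommGroup Y] [NormedSpace ℝ Y]
    (W : Submodule ℝ Y) (hW : IsClosed (W : Set Y)) {y : Y} (hy : y ∉ W) :
    ∃ l : StrongDual ℝ Y, (∀ w ∈ W, l w = 0) ∧ l y ≠ 0 := by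
  obtain ⟨l, u, hl, hu⟩ := geometric_hahn_banach_closed_point W.convex hW hy
  have hu0 : 0 < u := by simpa using hl 0 W.zero_mem
  refine ⟨l, fun w hw => ?_, (hu0.trans hu).ne'⟩
  by_contra hne
  have h := hl ((u / l w) • w) (W.smul_mem _ hw)
  rw [map_smul, smul_eq_mul, div_mul_cancel₀ _ hne] at h
  exact h.false

/-- The dual of a separable closed subspace of a reflexive space is separable. -/
theorem IsReflexive.separableSpace_dual_submodule {Y : Type*} [NormedAddCommGroup Y]
    [NormedSpace ℝ Y] (hY : IsReflexive Y) (Z : Submodule ℝ Y) (hZ : IsClosed (Z : Set Y))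
    [TopologicalSpace.SeparableSpace Z] : TopologicalSpace.SeparableSpace (StrongDual ℝ Z) := by
  obtain ⟨D, hDc, hDd⟩ := TopologicalSpace.exists_countable_dense Z
  -- Norming functionals for the points of D; their restrictions to Z turn out to span a dense
  -- subspace.
  choose v hv1 hv2 using fun z : Z => exists_dual_vector'' ℝ (z : Y)
  let ρ : StrongDual ℝ Y → StrongDual ℝ Z := fun l => l.comp Z.subtypeL
  let W : Submodule ℝ (StrongDual ℝ Z) :=
    (Submodule.span ℝ ((fun z => ρ (v z)) '' D)).topologicalClosure
  have hWsep : TopologicalSpace.IsSeparable (W : Set (StrongDual ℝ Z)) := by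
    have h := ((hDc.image fun z => ρ (v z)).isSeparable.span (R := ℝ)).closure
    exact h
  have htop : W = ⊤ := by
    by_contra hne
    obtain ⟨m, hm⟩ : ∃ m, m ∉ W := by
      by_contra! h
      exact hne ((Submodule.eq_top_iff').2 h)
    have hWc : IsClosed (W : Set (StrongDual ℝ Z)) := Submodule.isClosed_topologicalClosure _
    obtain ⟨φ, hφ0, hφm⟩ :=
      exists_dual_eq_zero_of_notMem (Y := StrongDual ℝ Z) W hWc hm
    -- Pulled back along restriction, φ lies in the bidual of Y, so it is evaluation at some y.
    obtain ⟨y, hy⟩ := hY (φ.comp ((ContinuousLinearMap.compL ℝ Z Y ℝ).flip Z.subtypeL))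
    have hφ : ∀ l : StrongDual ℝ Y, φ (ρ l) = l y := fun l =>
      (congrArg (fun T : StrongDual ℝ (StrongDual ℝ Y) => T l) hy).symm
    have hyZ : y ∈ Z := by
      by_contra hyZ
      obtain ⟨l, hl0, hly⟩ := exists_dual_eq_zero_of_notMem Z hZ hyZ
      apply hly
      have hρ : ρ l = 0 := by
        ext z
        exact hl0 z z.2
      rw [← hφ, hρ, map_zero]
    -- Since v z annihilates y and norms z, ‖z‖ = v z (z - y). By density the bound reaches z = y
    -- and forces y = 0.
    have hle : ∀ z ∈ D, ‖(z : Y)‖ ≤ ‖(z : Y) - y‖ := by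
      intro z hz
      have h0 : v z y = 0 := by
        rw [← hφ]
        exact hφ0 _ (Submodule.le_topologicalClosure _
          (Submodule.subset_span (Set.mem_image_of_mem _ hz)))
      have h1 : v z ((z : Y) - y) = ‖(z : Y)‖ := by
        rw [map_sub, h0, hv2]; simp
      calc ‖(z : Y)‖ = v z ((z : Y) - y) := h1.symm
        _ ≤ ‖v z ((z : Y) - y)‖ := Real.le_norm_self _
        _ ≤ ‖v z‖ * ‖(z : Y) - y‖ := (v z).le_opNorm _
        _ ≤ 1 * ‖(z : Y) - y‖ := by gcongr; exact hv1 z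
        _ = _ := one_mul _
    have hcl : ∀ z : Z, ‖(z : Y)‖ ≤ ‖(z : Y) - y‖ := fun z =>
      (isClosed_le (by fun_prop) (by fun_prop) :
        IsClosed {z : Z | ‖(z : Y)‖ ≤ ‖(z : Y) - y‖}).closure_subset_iff.2 hle (hDd z)
    have hy0 : y = 0 := by simpa using hcl ⟨y, hyZ⟩
    obtain ⟨l, hl, -⟩ := exists_extension_norm_eq Z m
    apply hφm
    have hρ : ρ l = m := by
      ext z
      exact hl z
    rw [← hρ, hφ, hy0, map_zero]
  rw [htop, Submodule.top_coe] at hWsep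
  exact TopologicalSpace.isSeparable_univ_iff.1 hWsep

/-- A continuous convex function has a subgradient at every point. -/
theorem exists_subgradient {Z : Type*} [NormedAddCommGroup Z] [NormedSpace ℝ Z] {F : Z → ℝ}
    (hconv : ConvexOn ℝ Set.univ F) (hcont : Continuous F) (z : Z) :
    ∃ s : StrongDual ℝ Z, ∀ w, F z + s (w - z) ≤ F w := by
  have hopen : IsOpen {p : Z × ℝ | p.1 ∈ Set.univ ∧ F p.1 < p.2} := by
    simpa using isOpen_lt (hcont.comp continuous_fst) continuous_snd
  -- Separate (z, F z) from the open strict epigraph. The vertical component c of l is negative, so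
  -- the hyperplane is a graph, of slope -l(·, 0) / c.
  obtain ⟨l, hl⟩ := geometric_hahn_banach_open_point (x := (z, F z)) hconv.convex_strict_epigraph
    hopen (by simp)
  set c : ℝ := l (0, 1) with hc
  have hsplit : ∀ (w : Z) (t : ℝ), l (w, t) = l (w, 0) + t * c := by
    intro w t
    have : ((w, t) : Z × ℝ) = (w, 0) + t • (0, 1) := by simp
    rw [this, map_add, map_smul, smul_eq_mul]
  have hlt : ∀ (w : Z) (t : ℝ), F w < t → l (w, t) < l (z, F z) := fun w t h =>
    hl (w, t) ⟨trivial, h⟩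
  have hcneg : c < 0 := by
    have h := hlt z (F z + 1) (by linarith)
    rw [hsplit, hsplit z (F z)] at h
    linarith
  have hle : ∀ w, l (w, F w) ≤ l (z, F z) := by
    intro w
    refine le_of_tendsto (f := fun t => l (w, t)) (x := 𝓝[>] F w)
      ((Continuous.tendsto (by fun_prop) _).mono_left nhdsWithin_le_nhds) ?_
    filter_upwards [self_mem_nhdsWithin] with t ht using (hlt w t ht).le
  refine ⟨(-c⁻¹) • l.comp (ContinuousLinearMap.inl ℝ Z ℝ), fun w => ?_⟩
  have h := hle w
  rw [hsplit, hsplit z] at h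
  have h1 : l (w - z, 0) = l (w, 0) - l (z, 0) := by
    rw [← map_sub]; simp
  have h2 : (-c⁻¹) * (l (w, 0) - l (z, 0)) ≤ F w - F z := by
    have h3 : l (w, 0) - l (z, 0) ≤ (-c) * (F w - F z) := by linarith
    calc (-c⁻¹) * (l (w, 0) - l (z, 0)) ≤ (-c⁻¹) * ((-c) * (F w - F z)) :=
          mul_le_mul_of_nonneg_left h3 (by have := inv_neg''.2 hcneg; linarith)
      _ = F w - F z := by field_simp [hcneg.ne]
  simp only [smul_apply, ContinuousLinearMap.comp_apply,
    ContinuousLinearMap.inl_apply, smul_eq_mul, h1]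
  linarith

/-- On a Banach space with separable dual, a continuous convex function is nearly affine on some
ball inside any given nonempty open set. -/
theorem exists_ball_nearly_affine {Z : Type*} [NormedAddCommGroup Z] [NormedSpace ℝ Z]
    [CompleteSpace Z] [TopologicalSpace.SeparableSpace (StrongDual ℝ Z)] {F : Z → ℝ}
    (hconv : ConvexOn ℝ Set.univ F) (hcont : Continuous F) {U : Set Z} (hU : IsOpen U)
    (hne : U.Nonempty) {ε : ℝ} (hε : 0 < ε) :
    ∃ z ∈ U, ∃ r > 0, ball z r ⊆ U ∧ ∃ s : StrongDual ℝ Z, ∀ x ∈ ball z r, ∀ y ∈ ball z r,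
      F y - F x - s (y - x) ≤ ε * ‖y - x‖ := by
  obtain ⟨D, hDc, hDd⟩ := TopologicalSpace.exists_countable_dense (StrongDual ℝ Z)
  have := hDc.to_subtype
  -- Points with s as subgradient up to ε. A true subgradient can be approximated from D, so these
  -- countably many closed sets cover Z and Baire applies.
  let A : D → Set Z := fun s => {z | ∀ w, F z + s.1 (w - z) - ε * ‖w - z‖ ≤ F w}
  have hAc : ∀ s, IsClosed (A s) := by
    intro s
    simp only [A, Set.ofPred_forall]
    exact isClosed_iInter fun w => isClosed_le (by fun_prop) (by fun_prop)
  have hAu : ∀ z, ∃ s, z ∈ A s := by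
    intro z
    obtain ⟨s, hs⟩ := exists_subgradient hconv hcont z
    obtain ⟨d, hd, hdist⟩ := hDd.exists_dist_lt s hε
    refine ⟨⟨d, hd⟩, fun w => ?_⟩
    have h1 : (d - s) (w - z) ≤ ε * ‖w - z‖ :=
      (Real.le_norm_self _).trans (((d - s).le_opNorm _).trans (by
        gcongr; rw [← dist_eq_norm, dist_comm]; exact hdist.le))
    rw [sub_apply] at h1
    have h2 := hs w
    show F z + d (w - z) - ε * ‖w - z‖ ≤ F w
    linarith
  have hdense : Dense (⋃ s, interior (A s)) :=
    dense_iUnion_interior_of_closed hAc (Set.iUnion_eq_univ_iff.2 hAu)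
  obtain ⟨z, hzU, hz⟩ := hdense.inter_open_nonempty U hU hne
  obtain ⟨s, hs⟩ := Set.mem_iUnion.1 hz
  obtain ⟨r, hr, hball⟩ := Metric.isOpen_iff.1 (hU.inter isOpen_interior) z ⟨hzU, hs⟩
  refine ⟨z, hzU, r, hr, fun x hx => (hball hx).1, s.1, fun x _ y hy => ?_⟩
  -- The inequality is based at y and tested at x, which yields an upper bound for F y - F x.
  have h := interior_subset (hball hy).2 x
  rw [← neg_sub y x, map_neg, norm_neg] at h
  linarith

/-- A point lies in a separable closed subspace having a dense countable subset that is stable under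
countably many prescribed maps. -/
theorem exists_separable_submodule_stable {Y : Type*} [NormedAddCommGroup Y] [NormedSpace ℝ Y]
    (w : ℕ → Y → Y) (z₀ : Y) :
    ∃ (S : Set Y) (Z : Submodule ℝ Y), S.Countable ∧ (Z : Set Y) = closure S ∧ z₀ ∈ S ∧
      ∀ z ∈ S, ∀ n, w n z ∈ S := by
  let T : Set Y → Set Y := fun A => A ∪ (Set.image2 (· + ·) A A ∪
    ((⋃ a : ℚ, (fun z => (a : ℝ) • z) '' A) ∪ ⋃ n, w n '' A))
  let D : ℕ → Set Y := fun n => T^[n] {z₀}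
  have hDsucc : ∀ n, D (n + 1) = T (D n) := fun n => Function.iterate_succ_apply' T n _
  have hmono : Monotone D := monotone_nat_of_le_succ fun n => by
    rw [hDsucc]; exact Set.subset_union_left
  have hcount : ∀ n, (D n).Countable := by
    intro n
    induction n with
    | zero => exact Set.countable_singleton z₀
    | succ n ih =>
      rw [hDsucc]
      exact ih.union ((ih.image2 ih _).union ((Set.countable_iUnion fun a => ih.image _).union
        (Set.countable_iUnion fun a => ih.image _)))
  let S : Set Y := ⋃ n, D n
  have hadd : ∀ x ∈ S, ∀ y ∈ S, x + y ∈ S := by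
    intro x hx y hy
    obtain ⟨m, hm⟩ := Set.mem_iUnion.1 hx
    obtain ⟨n, hn⟩ := Set.mem_iUnion.1 hy
    refine Set.mem_iUnion.2 ⟨max m n + 1, ?_⟩
    rw [hDsucc]
    exact Or.inr (Or.inl ⟨x, hmono (le_max_left _ _) hm, y, hmono (le_max_right _ _) hn, rfl⟩)
  have hsmul : ∀ a : ℚ, ∀ x ∈ S, (a : ℝ) • x ∈ S := by
    intro a x hx
    obtain ⟨m, hm⟩ := Set.mem_iUnion.1 hx
    refine Set.mem_iUnion.2 ⟨m + 1, ?_⟩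
    rw [hDsucc]
    exact Or.inr (Or.inr (Or.inl (Set.mem_iUnion.2 ⟨a, x, hm, rfl⟩)))
  have hw : ∀ x ∈ S, ∀ n, w n x ∈ S := by
    intro x hx n
    obtain ⟨m, hm⟩ := Set.mem_iUnion.1 hx
    refine Set.mem_iUnion.2 ⟨m + 1, ?_⟩
    rw [hDsucc]
    exact Or.inr (Or.inr (Or.inr (Set.mem_iUnion.2 ⟨n, x, hm, rfl⟩)))
  have hz₀ : z₀ ∈ S := Set.mem_iUnion.2 ⟨0, rfl⟩
  let Z : Submodule ℝ Y :=
    { carrier := closure S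
      add_mem' := fun hx hy => map_mem_closure₂ continuous_add hx hy hadd
      zero_mem' := subset_closure (by simpa using hsmul 0 z₀ hz₀)
      -- S is stable only under rational scalars; real ones are reached by density.
      smul_mem' := fun c x hx =>
        map_mem_closure₂ (s := Set.range ((↑) : ℚ → ℝ)) continuous_smul
          (Rat.denseRange_cast c) hx (by rintro _ ⟨a, rfl⟩ y hy; exact hsmul a y hy) }
  exact ⟨S, Z, Set.countable_iUnion hcount, rfl, hz₀, hw⟩

/-- On a reflexive Banach space, every nonempty open set contains a point at which a given
continuous convex function is smooth up to `ε`. -/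
theorem IsReflexive.exists_secondDiff_le {Y : Type*} [NormedAddCommGroup Y] [NormedSpace ℝ Y]
    [CompleteSpace Y] (hY : IsReflexive Y) {F : Y → ℝ} (hconv : ConvexOn ℝ Set.univ F)
    (hcont : Continuous F) {U : Set Y} (hU : IsOpen U) (hne : U.Nonempty) {ε : ℝ} (hε : 0 < ε) :
    ∃ z ∈ U, ∃ r > 0, ∀ h, ‖h‖ ≤ r → F (z + h) + F (z - h) - 2 * F z ≤ ε * ‖h‖ := by
  by_contra! H
  obtain ⟨z₀, hz₀⟩ := hne
  -- Separable reduction: w n z is a bad direction at z of size at most 1/(n+1), with filler 0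
  -- outside U. A separable subspace stable under all w n inherits the failure.
  have H' : ∀ (n : ℕ) (z : Y), ∃ h, z ∈ U → ‖h‖ ≤ 1 / ((n : ℝ) + 1) ∧
      ε * ‖h‖ < F (z + h) + F (z - h) - 2 * F z := by
    intro n z
    by_cases hz : z ∈ U
    · obtain ⟨h, h1, h2⟩ := H z hz (1 / ((n : ℝ) + 1)) (by positivity)
      exact ⟨h, fun _ => ⟨h1, h2⟩⟩
    · exact ⟨0, fun h => (hz h).elim⟩
  choose w hw using H'
  obtain ⟨S, Z, hSc, hZS, hzS, hSw⟩ := exists_separable_submodule_stable w z₀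
  have hZc : IsClosed (Z : Set Y) := hZS ▸ isClosed_closure
  have hSZ : ∀ z ∈ S, z ∈ Z := fun z hz => by
    rw [← SetLike.mem_coe, hZS]; exact subset_closure hz
  have : TopologicalSpace.SeparableSpace Z := by
    have h := hSc.isSeparable.closure
    rw [← hZS] at h
    exact h.separableSpace
  have : CompleteSpace Z := hZc.completeSpace_coe
  have := hY.separableSpace_dual_submodule Z hZc
  -- Two one-sided estimates, at x + h and x - h, will be added, hence ε / 2.
  obtain ⟨z, -, r, hr, hball, s, hs⟩ := exists_ball_nearly_affine (F := fun z : Z => F z)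
    (U := ((↑) : Z → Y) ⁻¹' U) (ε := ε / 2)
    ⟨convex_univ, fun x _ y _ a b ha hb hab => hconv.2 trivial trivial ha hb hab⟩ (hcont.comp continuous_subtype_val)
    (hU.preimage continuous_subtype_val) ⟨⟨z₀, hSZ _ hzS⟩, hz₀⟩ (by positivity)
  obtain ⟨x, hxS, hxz⟩ : ∃ x ∈ S, dist (z : Y) x < r / 2 :=
    Metric.mem_closure_iff.1 (by rw [← hZS]; exact z.2) _ (by positivity)
  obtain ⟨n, hn⟩ := exists_nat_one_div_lt (show 0 < r / 2 by positivity)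
  let x' : Z := ⟨x, hSZ _ hxS⟩
  let h' : Z := ⟨w n x, hSZ _ (hSw x hxS n)⟩
  have hxz' : ‖x' - z‖ < r / 2 := by
    rw [← dist_eq_norm, dist_comm]; exact hxz
  have hxb : x' ∈ ball z r := by
    rw [mem_ball, dist_eq_norm]; linarith
  obtain ⟨h1, h2⟩ := hw n x (hball hxb)
  have h1' : ‖h'‖ < r / 2 := h1.trans_lt hn
  have hp : x' + h' ∈ ball z r := by
    rw [mem_ball, dist_eq_norm, add_sub_right_comm]
    exact (norm_add_le _ _).trans_lt (by linarith)
  have hm : x' - h' ∈ ball z r := by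
    rw [mem_ball, dist_eq_norm, sub_right_comm]
    exact (norm_sub_le _ _).trans_lt (by linarith)
  have e1 := hs x' hxb _ hp
  have e2 := hs x' hxb _ hm
  rw [add_sub_cancel_left] at e1
  rw [sub_sub_cancel_left, map_neg, norm_neg] at e2
  have e3 : ‖h'‖ = ‖w n x‖ := rfl
  simp only [Submodule.coe_add, Submodule.coe_sub, e3] at e1 e2
  change F (x + w n x) - F x - _ ≤ _ at e1
  change F (x - w n x) - F x - _ ≤ _ at e2
  linarith

/-- The points at which the symmetric second differences of `F` at scale `r` are `o(r)` along a
sequence of scales. For convex `F` these are the points of Fréchet differentiability. -/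
def smoothPoints {Y : Type*} [NormedAddCommGroup Y] (F : Y → ℝ) : Set Y :=
  {z | ∀ ε > 0, ∃ r > 0, r ≤ 1 ∧ ∀ h, ‖h‖ ≤ r → F (z + h) + F (z - h) - 2 * F z ≤ ε * r}

/-- A Lipschitz convex function on a reflexive Banach space is smooth on a dense set. -/
theorem IsReflexive.dense_smoothPoints {Y : Type*} [NormedAddCommGroup Y] [NormedSpace ℝ Y]
    [CompleteSpace Y] (hY : IsReflexive Y) {F : Y → ℝ} (hconv : ConvexOn ℝ Set.univ F)
    {L : ℝ} (hL : 0 ≤ L) (hlip : ∀ x y, F x - F y ≤ L * ‖x - y‖) : Dense (smoothPoints F) := by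
  have hcont : Continuous F := by
    refine (LipschitzWith.of_dist_le_mul (K := ⟨L, hL⟩) fun x y => ?_).continuous
    rw [Real.dist_eq, dist_eq_norm, abs_le]
    have h1 := hlip x y
    have h2 := hlip y x
    rw [norm_sub_rev] at h2
    change -(L * ‖x - y‖) ≤ _ ∧ _ ≤ L * ‖x - y‖
    exact ⟨by linarith, h1⟩
  -- The bound involves the scale r rather than ‖h‖, so it survives small moves of z.
  let O : ℕ → Set Y := fun n => {z | ∃ r > 0, r ≤ 1 ∧
    ∀ h, ‖h‖ ≤ r → F (z + h) + F (z - h) - 2 * F z ≤ 1 / ((n : ℝ) + 1) * r}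
  have hdense : Dense (⋂ n, interior (O n)) := by
    refine dense_iInter_of_isOpen (fun n => isOpen_interior) fun n => ?_
    refine dense_iff_inter_open.2 fun U hU hne => ?_
    set ε : ℝ := 1 / ((n : ℝ) + 1) with hε
    have hεp : 0 < ε := by positivity
    obtain ⟨z, hzU, r, hr, hz⟩ := hY.exists_secondDiff_le hconv hcont hU hne (half_pos hεp)
    refine ⟨z, hzU, mem_interior_iff_mem_nhds.2 ?_⟩
    set r' := min r 1 with hr'
    have hr'0 : 0 < r' := lt_min hr one_pos
    -- Moving the centre by ρ changes the second difference by at most 4 L ρ; this radius keeps that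
    -- below ε r' / 2.
    refine Metric.mem_nhds_iff.2 ⟨ε * r' / (8 * (L + 1)), by positivity, fun y hy => ?_⟩
    refine ⟨r', hr'0, min_le_right _ _, fun h hh => ?_⟩
    have h0 := hz h (hh.trans (min_le_left _ _))
    have h1 := hlip (y + h) (z + h)
    have h2 := hlip (y - h) (z - h)
    have h3 := hlip z y
    rw [add_sub_add_right_eq_sub] at h1
    rw [sub_sub_sub_cancel_right] at h2
    rw [norm_sub_rev] at h3
    rw [mem_ball, dist_eq_norm, lt_div_iff₀ (by positivity)] at hy
    have h4 : ε / 2 * ‖h‖ ≤ ε / 2 * r' := by gcongr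
    nlinarith [norm_nonneg (y - z)]
  refine hdense.mono fun z hz ε hε => ?_
  obtain ⟨n, hn⟩ := exists_nat_one_div_lt hε
  obtain ⟨r, hr, hr1, h⟩ := interior_subset (Set.mem_iInter.1 hz n)
  exact ⟨r, hr, hr1, fun k hk => (h k hk).trans (by gcongr)⟩

/-- Approximate subgradients at a smooth point converge in norm. -/
theorem cauchySeq_of_mem_smoothPoints {X : Type*} [NormedAddCommGroup X] [NormedSpace ℝ X]
    {φ : StrongDual ℝ X → ℝ} {ξ : StrongDual ℝ X} (hξ : ξ ∈ smoothPoints φ) {y : ℕ → X} {e : ℕ → ℝ}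
    (he : Tendsto e atTop (𝓝 0))
    (hy : ∀ n, ∀ h : StrongDual ℝ X, ‖h‖ ≤ 1 → h (y n) ≤ φ (ξ + h) - φ ξ + e n) :
    CauchySeq y := by
  refine Metric.cauchySeq_iff.2 fun ε hε => ?_
  obtain ⟨r, hr, hr1, hsd⟩ := hξ (ε / 4) (by positivity)
  obtain ⟨N, hN⟩ := eventually_atTop.1
    (he.eventually (gt_mem_nhds (show 0 < ε / 4 * r by positivity)))
  refine ⟨N, fun m hm n hn => ?_⟩
  rw [dist_eq_norm]
  obtain ⟨v, hv1, hv⟩ := exists_dual_vector'' ℝ (y m - y n)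
  have hnorm : ‖r • v‖ ≤ r := by
    rw [norm_smul, Real.norm_of_nonneg hr.le]
    exact mul_le_of_le_one_right hr.le hv1
  -- Test y m with r • v and y n with -(r • v): the sum bounds r ‖y m - y n‖ by a second difference
  -- plus two errors, each at most ε r / 4.
  have h1 := hy m (r • v) (hnorm.trans hr1)
  have h2 := hy n (-(r • v)) (by rw [norm_neg]; exact hnorm.trans hr1)
  have h3 := hsd _ hnorm
  have h4 : r * ‖y m - y n‖ = r * v (y m) - r * v (y n) := by
    rw [← mul_sub, ← map_sub, hv]; rfl
  simp only [neg_apply, smul_apply, smul_eq_mul, ← sub_eq_add_neg] at h1 h2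
  have h5 := hN m hm
  have h6 := hN n hn
  have h7 : r * ‖y m - y n‖ < r * ε := by nlinarith
  exact lt_of_mul_lt_mul_left h7 hr.le

/-! ### The conjugate and attainment at its smooth points -/

/-- The conjugate `ξ ↦ sup_{x ∈ E} (ξ (x - x₀) - g x)` of the restriction of `g` to `E`,
with `x₀` as origin. -/
noncomputable def conjOn {X : Type*} [NormedAddCommGroup X] [NormedSpace ℝ X] (E : Set X)
    (g : X → ℝ) (x₀ : X) (ξ : StrongDual ℝ X) : ℝ :=
  ⨆ x : E, (ξ (x - x₀) - g x)

/-- A nonnegative function `g` on a bounded set `E` containing its zero `x₀`. -/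
structure IsNonnegNear {X : Type*} [NormedAddCommGroup X] (E : Set X) (g : X → ℝ) (x₀ : X)
    (δ : ℝ) : Prop where
  mem : x₀ ∈ E
  zero : g x₀ = 0
  nonneg : ∀ x ∈ E, 0 ≤ g x
  bound : ∀ x ∈ E, ‖x - x₀‖ ≤ δ

/-- Sequential closedness of the epigraph of `g` over `E`. -/
def IsSeqClosedEpi {X : Type*} [TopologicalSpace X] (E : Set X) (g : X → ℝ) : Prop :=
  ∀ (y : ℕ → X) (a : ℕ → ℝ) (z : X) (b : ℝ), (∀ n, y n ∈ E) → (∀ n, g (y n) ≤ a n) →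
    Tendsto y atTop (𝓝 z) → Tendsto a atTop (𝓝 b) → z ∈ E ∧ g z ≤ b

theorem IsNonnegNear.delta_nonneg {X : Type*} [NormedAddCommGroup X] {E : Set X} {g : X → ℝ}
    {x₀ : X} {δ : ℝ} (h : IsNonnegNear E g x₀ δ) : 0 ≤ δ :=
  (norm_nonneg _).trans (h.bound x₀ h.mem)

namespace IsNonnegNear

variable {X : Type*} [NormedAddCommGroup X] [NormedSpace ℝ X] {E : Set X} {g : X → ℝ} {x₀ : X}
  {δ : ℝ}

theorem apply_sub_le (h : IsNonnegNear E g x₀ δ) (ξ : StrongDual ℝ X) {x : X} (hx : x ∈ E) :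
    ξ (x - x₀) ≤ δ * ‖ξ‖ := by
  rw [mul_comm]
  exact (Real.le_norm_self _).trans ((ξ.le_opNorm _).trans (by gcongr; exact h.bound x hx))

theorem le_conjOn (h : IsNonnegNear E g x₀ δ) (ξ : StrongDual ℝ X) {x : X} (hx : x ∈ E) :
    ξ (x - x₀) - g x ≤ conjOn E g x₀ ξ := by
  refine le_ciSup (f := fun x : E => ξ (x - x₀) - g x) ⟨δ * ‖ξ‖, ?_⟩ ⟨x, hx⟩
  rintro _ ⟨y, rfl⟩
  have h1 := h.apply_sub_le ξ y.2
  have h2 := h.nonneg y y.2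
  show ξ (y - x₀) - g y ≤ _
  linarith

theorem conjOn_le (h : IsNonnegNear E g x₀ δ) {ξ : StrongDual ℝ X} {a : ℝ}
    (ha : ∀ x ∈ E, ξ (x - x₀) - g x ≤ a) : conjOn E g x₀ ξ ≤ a := by
  have : Nonempty E := ⟨⟨x₀, h.mem⟩⟩
  exact ciSup_le fun x => ha x x.2

theorem exists_lt_of_lt_conjOn (h : IsNonnegNear E g x₀ δ) {ξ : StrongDual ℝ X} {a : ℝ}
    (ha : a < conjOn E g x₀ ξ) : ∃ x ∈ E, a < ξ (x - x₀) - g x := by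
  by_contra! H
  exact ha.not_ge (h.conjOn_le H)

theorem conjOn_nonneg (h : IsNonnegNear E g x₀ δ) (ξ : StrongDual ℝ X) :
    0 ≤ conjOn E g x₀ ξ := by
  simpa [h.zero] using h.le_conjOn ξ h.mem

theorem conjOn_zero (h : IsNonnegNear E g x₀ δ) : conjOn E g x₀ 0 = 0 :=
  le_antisymm (h.conjOn_le fun x hx => by simpa using h.nonneg x hx) (h.conjOn_nonneg 0)

theorem conjOn_sub_le (h : IsNonnegNear E g x₀ δ) (ξ η : StrongDual ℝ X) :
    conjOn E g x₀ ξ - conjOn E g x₀ η ≤ δ * ‖ξ - η‖ := by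
  rw [sub_le_iff_le_add]
  refine h.conjOn_le fun x hx => ?_
  have h1 := h.apply_sub_le (ξ - η) hx
  rw [sub_apply] at h1
  have h2 := h.le_conjOn η hx
  linarith

theorem continuous_conjOn (h : IsNonnegNear E g x₀ δ) : Continuous (conjOn E g x₀) := by
  refine (LipschitzWith.of_dist_le_mul (K := ⟨δ, h.delta_nonneg⟩) fun x y => ?_).continuous
  rw [Real.dist_eq, dist_eq_norm, abs_le]
  have h1 := h.conjOn_sub_le x y
  have h2 := h.conjOn_sub_le y x
  rw [norm_sub_rev] at h2
  change -(δ * ‖x - y‖) ≤ _ ∧ _ ≤ δ * ‖x - y‖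
  exact ⟨by linarith, h1⟩

theorem convexOn_conjOn (h : IsNonnegNear E g x₀ δ) :
    ConvexOn ℝ Set.univ (conjOn E g x₀) := by
  refine ⟨convex_univ, fun ξ _ η _ a b ha hb hab => h.conjOn_le fun x hx => ?_⟩
  have h1 := mul_le_mul_of_nonneg_left (h.le_conjOn ξ hx) ha
  have h2 := mul_le_mul_of_nonneg_left (h.le_conjOn η hx) hb
  have h3 : g x = a * g x + b * g x := by rw [← add_mul, hab, one_mul]
  simp only [add_apply, smul_apply, smul_eq_mul]
  linarith

/-- At smooth points of the conjugate the tilted problem has a solution. -/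
theorem exists_conjOn_le [CompleteSpace X] (h : IsNonnegNear E g x₀ δ) (hE : IsSeqClosedEpi E g)
    {ξ : StrongDual ℝ X} (hξ : ξ ∈ smoothPoints (conjOn E g x₀)) :
    ∃ x ∈ E, conjOn E g x₀ ξ ≤ ξ (x - x₀) - g x := by
  choose y hyE hy using fun n : ℕ => h.exists_lt_of_lt_conjOn
    (show conjOn E g x₀ ξ - 1 / ((n : ℝ) + 1) < conjOn E g x₀ ξ from
      sub_lt_self _ (by positivity))
  have hlim := tendsto_one_div_add_atTop_nhds_zero_nat (𝕜 := ℝ)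
  have hc : CauchySeq fun n => y n - x₀ := by
    -- A maximizing sequence consists of approximate subgradients of the conjugate at ξ.
    refine cauchySeq_of_mem_smoothPoints hξ hlim fun n k _ => ?_
    have h1 := h.le_conjOn (ξ + k) (hyE n)
    have h2 := hy n
    rw [add_apply] at h1
    linarith
  obtain ⟨v, hv⟩ := cauchySeq_tendsto_of_complete hc
  have hyv : Tendsto y atTop (𝓝 (v + x₀)) := by simpa using hv.add_const x₀
  obtain ⟨hz, hgz⟩ := hE y
    (fun n => ξ (y n - x₀) - (conjOn E g x₀ ξ - 1 / ((n : ℝ) + 1))) (v + x₀)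
    (ξ v - (conjOn E g x₀ ξ - 0)) hyE (fun n => by linarith [hy n]) hyv
    (((ξ.continuous.tendsto v).comp hv).sub (tendsto_const_nhds.sub hlim))
  refine ⟨_, hz, ?_⟩
  rw [add_sub_cancel_right]
  linarith

/-- If x attains the supremum at a smooth η, then x tested at s • η gives s (η (x - x₀)) - g x,
which is s times the conjugate at η minus (1 - s) g x; `hμ` bounds g x. Density of smooth points and
continuity give all ξ. -/
theorem conjOn_smul_ge [CompleteSpace X] (h : IsNonnegNear E g x₀ δ) (hE : IsSeqClosedEpi E g)
    (hX : IsReflexive (StrongDual ℝ X)) {q μ : ℝ} (hq : 0 ≤ q)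
    (hμ : ∀ (ξ : StrongDual ℝ X), ∀ x ∈ E, (∀ y ∈ E, ξ (y - x₀) - g y ≤ ξ (x - x₀) - g x) →
      g x ≤ μ * ‖ξ‖ ^ q) {s : ℝ} (hs : s ≤ 1) (ξ : StrongDual ℝ X) :
    s * conjOn E g x₀ ξ - (1 - s) * (μ * ‖ξ‖ ^ q) ≤ conjOn E g x₀ (s • ξ) := by
  have hcont := h.continuous_conjOn
  have hpow : Continuous fun ξ : StrongDual ℝ X => ‖ξ‖ ^ q :=
    continuous_norm.rpow_const fun _ => Or.inr hq
  have hd := hX.dense_smoothPoints h.convexOn_conjOn h.delta_nonneg h.conjOn_sub_le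
  refine (isClosed_le (by fun_prop) (by fun_prop) : IsClosed {ξ : StrongDual ℝ X |
    s * conjOn E g x₀ ξ - (1 - s) * (μ * ‖ξ‖ ^ q) ≤ conjOn E g x₀ (s • ξ)}).closure_subset_iff.2
    (fun η hη => ?_) (hd ξ)
  obtain ⟨x, hx, hxη⟩ := h.exists_conjOn_le hE hη
  have h1 := hμ η x hx fun y hy => (h.le_conjOn η hy).trans hxη
  have h2 := h.le_conjOn (s • η) hx
  have h3 := h.le_conjOn η hx
  have h4 : conjOn E g x₀ η = η (x - x₀) - g x := le_antisymm hxη h3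
  have h5 := mul_le_mul_of_nonneg_left h1 (sub_nonneg.2 hs)
  rw [smul_apply, smul_eq_mul] at h2
  show s * conjOn E g x₀ η - (1 - s) * (μ * ‖η‖ ^ q) ≤ conjOn E g x₀ (s • η)
  rw [h4]
  linarith

end IsNonnegNear

/-! ### Integrating the differential inequality along rays -/

/-- Integration of the differential inequality `φ t ≤ t φ' t + M t ^ q` in discrete form. -/
theorem div_le_of_forall_smul_ge {φ : ℝ → ℝ} {M q σ : ℝ} (hq : 1 < q)
    (hφ : ∀ s t, 0 < s → s < 1 → 0 < t → s * φ t - (1 - s) * (M * t ^ q) ≤ φ (s * t))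
    (hσ : Tendsto (fun t => φ t / t) (𝓝[>] 0) (𝓝 σ)) {t : ℝ} (ht : 0 < t) :
    φ t / t ≤ σ + M / (q - 1) * t ^ (q - 1) := by
  have hq1 : 0 < q - 1 := by linarith
  have hstep : ∀ s, 0 < s → s < 1 →
      φ t / t ≤ σ + M * s⁻¹ * ((1 - s ^ (q - 1)) / (1 - s))⁻¹ * t ^ (q - 1) := by
    intro s hs0 hs1
    have hsp : s ^ (q - 1) < 1 := Real.rpow_lt_one hs0.le hs1 hq1
    -- Solves A (1 - s^(q-1)) s = (1 - s) M, so that the error terms cancel and ψ u ≤ ψ (s u).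
    -- Iterating sends s^n t to 0; afterwards s → 1.
    set A : ℝ := M * s⁻¹ * ((1 - s ^ (q - 1)) / (1 - s))⁻¹ with hA
    have hAeq : A * (1 - s ^ (q - 1)) * s = (1 - s) * M := by
      rw [hA]
      have h1 : 1 - s ^ (q - 1) ≠ 0 := by linarith
      have h2 : 1 - s ≠ 0 := by linarith
      field_simp
    let ψ : ℝ → ℝ := fun u => φ u / u - A * u ^ (q - 1)
    have hψ : ∀ u, 0 < u → ψ u ≤ ψ (s * u) := by
      intro u hu
      have h1 := hφ s u hs0 hs1 hu
      have hpow : u ^ q = u ^ (q - 1) * u := by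
        rw [← Real.rpow_add_one hu.ne']; ring_nf
      show φ u / u - A * u ^ (q - 1) ≤ φ (s * u) / (s * u) - A * (s * u) ^ (q - 1)
      rw [Real.mul_rpow hs0.le hu.le, sub_le_iff_le_add, div_le_iff₀ hu]
      rw [hpow] at h1
      have h2 : (φ (s * u) / (s * u) - A * (s ^ (q - 1) * u ^ (q - 1)) + A * u ^ (q - 1)) * u
          = (φ (s * u) + A * (1 - s ^ (q - 1)) * s * (u ^ (q - 1) * u)) / s := by
        field_simp; ring
      rw [h2, hAeq, le_div_iff₀ hs0]
      linarith
    have hiter : ∀ n : ℕ, ψ t ≤ ψ (s ^ n * t) := by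
      intro n
      induction n with
      | zero => simp
      | succ n ih =>
        refine ih.trans ((hψ _ (by positivity)).trans_eq ?_)
        rw [pow_succ']; ring_nf
    have hz : Tendsto (fun n : ℕ => s ^ n * t) atTop (𝓝[>] 0) := by
      refine tendsto_nhdsWithin_iff.2 ⟨?_, Eventually.of_forall fun n => ?_⟩
      · simpa using (tendsto_pow_atTop_nhds_zero_of_lt_one hs0.le hs1).mul_const t
      · show 0 < s ^ n * t
        positivity
    have hpw : Tendsto (fun u : ℝ => u ^ (q - 1)) (𝓝[>] 0) (𝓝 0) := by
      have := (Real.continuousAt_rpow_const (0 : ℝ) (q - 1) (Or.inr hq1.le)).tendsto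
      rw [Real.zero_rpow hq1.ne'] at this
      exact this.mono_left nhdsWithin_le_nhds
    have hlim : Tendsto (fun n : ℕ => ψ (s ^ n * t)) atTop (𝓝 (σ - A * 0)) :=
      (hσ.sub (hpw.const_mul A)).comp hz
    have hfin := ge_of_tendsto' hlim hiter
    have : φ t / t - A * t ^ (q - 1) ≤ σ - A * 0 := hfin
    linarith
  -- The derivative of s^(q-1) at 1, which makes A tend to M / (q - 1).
  have hder : Tendsto (fun s : ℝ => (1 - s ^ (q - 1)) / (1 - s)) (𝓝[<] 1) (𝓝 (q - 1)) := by
    have h1 := (Real.hasDerivAt_rpow_const (x := 1) (p := q - 1) (Or.inl one_ne_zero))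
    rw [Real.one_rpow, mul_one, hasDerivAt_iff_tendsto_slope] at h1
    refine (h1.mono_left (nhdsWithin_mono _ fun x hx => ne_of_lt hx)).congr fun s => ?_
    rw [slope_def_field, Real.one_rpow, ← neg_div_neg_eq, neg_sub, neg_sub]
  have hinv : Tendsto (fun s : ℝ => s⁻¹) (𝓝[<] 1) (𝓝 1) := by
    have := (continuousAt_inv₀ (one_ne_zero (α := ℝ))).tendsto
    rw [inv_one] at this
    exact this.mono_left nhdsWithin_le_nhds
  have hlim : Tendsto (fun s : ℝ => σ + M * s⁻¹ * ((1 - s ^ (q - 1)) / (1 - s))⁻¹ * t ^ (q - 1))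
      (𝓝[<] 1) (𝓝 (σ + M * 1 * (q - 1)⁻¹ * t ^ (q - 1))) :=
    tendsto_const_nhds.add (((tendsto_const_nhds.mul hinv).mul (hder.inv₀ hq1.ne')).mul_const _)
  rw [mul_one, ← div_eq_mul_inv] at hlim
  refine ge_of_tendsto hlim ?_
  filter_upwards [Ioo_mem_nhdsLT (zero_lt_one (α := ℝ))] with s hs using hstep s hs.1 hs.2

/-! ### Directional derivatives at the origin -/

/-- The one-sided directional derivative at the origin of a convex function vanishing there. -/
noncomputable def dirDerivZero {Y : Type*} [AddCommGroup Y] [Module ℝ Y] (F : Y → ℝ) (ξ : Y) : ℝ :=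
  sInf ((fun t : ℝ => F (t • ξ) / t) '' Set.Ioi 0)

section DirDeriv

variable {Y : Type*} [NormedAddCommGroup Y] [NormedSpace ℝ Y] {F : Y → ℝ}

theorem bddBelow_quotients (h0 : ∀ ξ, 0 ≤ F ξ) (ξ : Y) :
    BddBelow ((fun t : ℝ => F (t • ξ) / t) '' Set.Ioi 0) :=
  ⟨0, by rintro _ ⟨t, ht, rfl⟩; exact div_nonneg (h0 _) (le_of_lt ht)⟩

theorem dirDerivZero_le (h0 : ∀ ξ, 0 ≤ F ξ) (ξ : Y) {t : ℝ} (ht : 0 < t) :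
    dirDerivZero F ξ ≤ F (t • ξ) / t :=
  csInf_le (bddBelow_quotients h0 ξ) ⟨t, ht, rfl⟩

theorem dirDerivZero_nonneg (h0 : ∀ ξ, 0 ≤ F ξ) (ξ : Y) : 0 ≤ dirDerivZero F ξ :=
  Real.sInf_nonneg (by rintro _ ⟨t, ht, rfl⟩; exact div_nonneg (h0 _) (le_of_lt ht))

theorem tendsto_dirDerivZero (h0 : ∀ ξ, 0 ≤ F ξ) (hz : F 0 = 0) (hconv : ConvexOn ℝ Set.univ F)
    (ξ : Y) : Tendsto (fun t : ℝ => F (t • ξ) / t) (𝓝[>] 0) (𝓝 (dirDerivZero F ξ)) := by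
  refine MonotoneOn.tendsto_nhdsGT (fun s hs t ht hst => ?_) (bddBelow_quotients h0 ξ)
  have hs' : 0 < s := hs
  have ht' : 0 < t := ht
  have ha : 0 ≤ s / t := by positivity
  have hb : 0 ≤ 1 - s / t := by rw [sub_nonneg, div_le_one ht']; exact hst
  have h := hconv.2 (Set.mem_univ (t • ξ)) (Set.mem_univ 0) ha hb (by ring)
  rw [smul_zero, add_zero, hz, smul_zero, add_zero, smul_smul, div_mul_cancel₀ _ ht'.ne',
    smul_eq_mul] at h
  show F (s • ξ) / s ≤ F (t • ξ) / t
  rw [div_le_iff₀ hs']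
  calc F (s • ξ) ≤ s / t * F (t • ξ) := h
    _ = F (t • ξ) / t * s := by ring

theorem convexOn_dirDerivZero (h0 : ∀ ξ, 0 ≤ F ξ) (hz : F 0 = 0)
    (hconv : ConvexOn ℝ Set.univ F) : ConvexOn ℝ Set.univ (dirDerivZero F) := by
  refine ⟨convex_univ, fun ξ _ η _ a b ha hb hab => ?_⟩
  refine le_of_tendsto_of_tendsto (tendsto_dirDerivZero h0 hz hconv (a • ξ + b • η))
    (((tendsto_dirDerivZero h0 hz hconv ξ).const_smul a).add
      ((tendsto_dirDerivZero h0 hz hconv η).const_smul b)) ?_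
  filter_upwards [self_mem_nhdsWithin] with t ht
  have ht' : 0 < t := ht
  have h := hconv.2 (Set.mem_univ (t • ξ)) (Set.mem_univ (t • η)) ha hb hab
  rw [smul_add, smul_comm t a, smul_comm t b]
  simp only [smul_eq_mul] at h ⊢
  rw [div_le_iff₀ ht']
  refine h.trans_eq ?_
  field_simp

theorem dirDerivZero_sub_le (h0 : ∀ ξ, 0 ≤ F ξ) (hz : F 0 = 0) (hconv : ConvexOn ℝ Set.univ F)
    {L : ℝ} (hlip : ∀ x y, F x - F y ≤ L * ‖x - y‖) (ξ η : Y) :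
    dirDerivZero F ξ - dirDerivZero F η ≤ L * ‖ξ - η‖ := by
  refine le_of_tendsto ((tendsto_dirDerivZero h0 hz hconv ξ).sub
    (tendsto_dirDerivZero h0 hz hconv η)) ?_
  filter_upwards [self_mem_nhdsWithin] with t ht
  have ht' : 0 < t := ht
  rw [← sub_div, div_le_iff₀ ht']
  refine (hlip _ _).trans_eq ?_
  rw [← smul_sub, norm_smul, Real.norm_of_nonneg ht'.le]
  ring

end DirDeriv

/-! ### From the bound at minimizers to power growth -/

namespace IsNonnegNear

variable {X : Type*} [NormedAddCommGroup X] [NormedSpace ℝ X] {E : Set X}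
  {g : X → ℝ} {x₀ : X} {δ : ℝ}

/-- If the difference quotients of the conjugate at the origin converge with a power rate and `x₀`
is the only zero of `g`, then the directional derivatives at the origin vanish. -/
theorem dirDerivZero_conjOn_eq_zero [CompleteSpace X] (h : IsNonnegNear E g x₀ δ) (hE : IsSeqClosedEpi E g)
    (hX : IsReflexive (StrongDual ℝ X)) (hstrict : ∀ x ∈ E, g x ≤ 0 → x = x₀) {q C : ℝ}
    (hq : 1 < q) (hC : 0 ≤ C)
    (hrate : ∀ (ξ : StrongDual ℝ X) (t : ℝ), 0 < t → conjOn E g x₀ (t • ξ) / t ≤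
      dirDerivZero (conjOn E g x₀) ξ + C * ‖ξ‖ ^ q * t ^ (q - 1)) (ξ : StrongDual ℝ X) :
    dirDerivZero (conjOn E g x₀) ξ = 0 := by
  set F := conjOn E g x₀ with hF
  set σ := dirDerivZero F with hσ
  have h0 : ∀ ξ, 0 ≤ F ξ := h.conjOn_nonneg
  have hlip : ∀ x y, σ x - σ y ≤ δ * ‖x - y‖ :=
    dirDerivZero_sub_le h0 h.conjOn_zero h.convexOn_conjOn h.conjOn_sub_le
  suffices hsm : ∀ ξ ∈ smoothPoints σ, σ ξ ≤ 0 by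
    have hd := hX.dense_smoothPoints
      (convexOn_dirDerivZero h0 h.conjOn_zero h.convexOn_conjOn) h.delta_nonneg hlip
    refine le_antisymm (le_of_forall_pos_le_add fun ε hε => ?_) (dirDerivZero_nonneg h0 ξ)
    have hδ : 0 < δ + 1 := by linarith [h.delta_nonneg]
    obtain ⟨η, hη, hdist⟩ := hd.exists_dist_lt ξ (div_pos hε hδ)
    rw [dist_eq_norm, lt_div_iff₀ hδ] at hdist
    have h1 := hlip ξ η
    have h2 := hsm η hη
    nlinarith [norm_nonneg (ξ - η)]
  clear ξ
  intro ξ hξ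
  let t : ℕ → ℝ := fun n => 1 / ((n : ℝ) + 1)
  have htp : ∀ n, 0 < t n := fun n => by positivity
  have ht0 : Tendsto t atTop (𝓝 0) := tendsto_one_div_add_atTop_nhds_zero_nat
  -- The error t n * t n is still o(1) after division by t n.
  choose y hyE hy using fun n : ℕ => h.exists_lt_of_lt_conjOn
    (show F (t n • ξ) - t n * t n < F (t n • ξ) from
      sub_lt_self _ (mul_pos (htp n) (htp n)))
  have hlow : ∀ n, σ ξ - t n + g (y n) / t n ≤ ξ (y n - x₀) := by
    intro n
    have h1 := hy n
    have h2 := dirDerivZero_le h0 ξ (htp n)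
    rw [le_div_iff₀ (htp n)] at h2
    rw [smul_apply, smul_eq_mul] at h1
    refine le_of_mul_le_mul_right ?_ (htp n)
    rw [add_mul, div_mul_cancel₀ _ (htp n).ne']
    linarith
  have hlow' : ∀ n, σ ξ - t n ≤ ξ (y n - x₀) := fun n => by
    linarith [hlow n, div_nonneg (h.nonneg _ (hyE n)) (htp n).le]
  have hpow : Tendsto (fun n => t n ^ (q - 1)) atTop (𝓝 0) := by
    have := (Real.continuousAt_rpow_const (0 : ℝ) (q - 1) (Or.inr (by linarith))).tendsto.comp ht0
    rwa [Real.zero_rpow (by linarith)] at this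
  have he : Tendsto (fun n => C * (‖ξ‖ + 1) ^ q * t n ^ (q - 1) + t n) atTop (𝓝 0) := by
    simpa using (hpow.const_mul (C * (‖ξ‖ + 1) ^ q)).add ht0
  have hc : CauchySeq fun n => y n - x₀ := by
    -- The rate is uniform for ‖k‖ ≤ 1, so y n - x₀ is an approximate subgradient of σ at ξ.
    refine cauchySeq_of_mem_smoothPoints hξ he fun n k hk => ?_
    have h1 := h.le_conjOn (t n • (ξ + k)) (hyE n)
    have h2 := hrate (ξ + k) (t n) (htp n)
    have h3 : ‖ξ + k‖ ^ q ≤ (‖ξ‖ + 1) ^ q :=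
      Real.rpow_le_rpow (norm_nonneg _) ((norm_add_le _ _).trans (by linarith)) (by linarith)
    have h4 : C * ‖ξ + k‖ ^ q * t n ^ (q - 1) ≤ C * (‖ξ‖ + 1) ^ q * t n ^ (q - 1) :=
      mul_le_mul_of_nonneg_right (mul_le_mul_of_nonneg_left h3 hC)
        (Real.rpow_nonneg (htp n).le _)
    have h5 : ξ (y n - x₀) + k (y n - x₀) ≤ F (t n • (ξ + k)) / t n + g (y n) / t n := by
      rw [← add_div, le_div_iff₀ (htp n)]
      rw [smul_apply, add_apply, smul_eq_mul] at h1
      linarith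
    linarith [hlow n]
  obtain ⟨v, hv⟩ := cauchySeq_tendsto_of_complete hc
  have hyv : Tendsto y atTop (𝓝 (v + x₀)) := by simpa using hv.add_const x₀
  have hlim : Tendsto (fun n => t n * (δ * ‖ξ‖) + t n * t n) atTop (𝓝 0) := by
    simpa using (ht0.mul_const (δ * ‖ξ‖)).add (ht0.mul ht0)
  -- Near-maximality and F ≥ 0 give g (y n) ≤ t n * (δ * ‖ξ‖) + t n * t n, so g ≤ 0 at the limit,
  -- which is therefore x₀.
  obtain ⟨hz, hgz⟩ := hE y _ (v + x₀) 0 hyE (fun n => by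
    have h1 := hy n
    have h2 := mul_le_mul_of_nonneg_left (h.apply_sub_le ξ (hyE n)) (htp n).le
    have h3 := h0 (t n • ξ)
    rw [smul_apply, smul_eq_mul] at h1
    linarith) hyv hlim
  have hv0 : v = 0 := by simpa using hstrict _ hz hgz
  have hfin := le_of_tendsto_of_tendsto' (tendsto_const_nhds.sub ht0)
    ((ξ.continuous.tendsto v).comp hv) hlow'
  simpa [hv0] using hfin

/-- A power bound on `g` at the solutions of all tilted problems bounds the conjugate. -/
theorem conjOn_le_rpow [CompleteSpace X] (h : IsNonnegNear E g x₀ δ) (hE : IsSeqClosedEpi E g)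
    (hX : IsReflexive (StrongDual ℝ X)) (hstrict : ∀ x ∈ E, g x ≤ 0 → x = x₀) {q μ : ℝ}
    (hq : 1 < q) (hμ0 : 0 ≤ μ)
    (hμ : ∀ (ξ : StrongDual ℝ X), ∀ x ∈ E, (∀ y ∈ E, ξ (y - x₀) - g y ≤ ξ (x - x₀) - g x) →
      g x ≤ μ * ‖ξ‖ ^ q) (ξ : StrongDual ℝ X) :
    conjOn E g x₀ ξ ≤ μ / (q - 1) * ‖ξ‖ ^ q := by
  have hrate : ∀ (ξ : StrongDual ℝ X) (t : ℝ), 0 < t → conjOn E g x₀ (t • ξ) / t ≤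
      dirDerivZero (conjOn E g x₀) ξ + μ / (q - 1) * ‖ξ‖ ^ q * t ^ (q - 1) := by
    intro ξ t ht
    refine (div_le_of_forall_smul_ge (φ := fun t => conjOn E g x₀ (t • ξ)) (M := μ * ‖ξ‖ ^ q) hq
      (fun s u _ hs1 hu => ?_)
      (tendsto_dirDerivZero h.conjOn_nonneg h.conjOn_zero h.convexOn_conjOn ξ) ht).trans_eq ?_
    · have := h.conjOn_smul_ge hE hX (by linarith) hμ hs1.le (u • ξ)
      rw [norm_smul, Real.norm_of_nonneg hu.le, Real.mul_rpow hu.le (norm_nonneg _), smul_smul]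
        at this
      convert this using 3
      ring
    · ring
  have h1 := hrate ξ 1 one_pos
  rw [h.dirDerivZero_conjOn_eq_zero hE hX hstrict hq (div_nonneg hμ0 (by linarith)) hrate ξ] at h1
  simpa using h1

/-- A power bound on the conjugate gives power growth. -/
theorem rpow_le_of_conjOn_le (h : IsNonnegNear E g x₀ δ) {p q μ : ℝ} (hpq : p.HolderConjugate q)
    (hμ : 0 < μ) (hF : ∀ ξ : StrongDual ℝ X, conjOn E g x₀ ξ ≤ μ / (q - 1) * ‖ξ‖ ^ q) {y : X}
    (hy : y ∈ E) : p ^ (-p) * μ ^ (-(p / q)) * ‖y - x₀‖ ^ p ≤ g y := by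
  obtain ⟨v, hv1, hv⟩ := exists_dual_vector'' ℝ (y - x₀)
  have hp : 0 < p := hpq.pos
  have hq1 : 0 < q - 1 := sub_pos.2 hpq.symm.lt
  have hq0 : 0 < q := hpq.symm.pos
  set d := ‖y - x₀‖ with hd
  have hd0 : 0 ≤ d := norm_nonneg _
  rcases hd0.eq_or_lt with h0 | hdp
  · rw [← h0, Real.zero_rpow hp.ne', mul_zero]
    exact h.nonneg y hy
  -- With 1 / (q - 1) = p - 1, the map τ ↦ τ d - μ (p - 1) τ^q is maximal at τ = u^(p-1), with value
  -- μ u^p.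
  set u := d / (p * μ) with hu
  have hup : 0 < u := by positivity
  have hduu : d = p * μ * u := by rw [hu]; field_simp
  have hr : 0 ≤ u ^ (p - 1) := by positivity
  have h1 := (h.le_conjOn (u ^ (p - 1) • v) hy).trans (hF _)
  have h2 : ‖u ^ (p - 1) • v‖ ^ q ≤ u ^ p := by
    rw [norm_smul, Real.norm_of_nonneg hr]
    calc (u ^ (p - 1) * ‖v‖) ^ q ≤ (u ^ (p - 1)) ^ q :=
          Real.rpow_le_rpow (by positivity) (mul_le_of_le_one_right hr hv1) hq0.le
      _ = u ^ p := by rw [← Real.rpow_mul hup.le, hpq.sub_one_mul_conj]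
  have h3 : μ / (q - 1) = μ * (p - 1) := by
    have := hpq.sub_one_mul_conj
    field_simp
    nlinarith
  have h4 : u ^ (p - 1) * d = p * μ * u ^ p := by
    have : u ^ p = u ^ (p - 1) * u := by rw [← Real.rpow_add_one hup.ne']; ring_nf
    rw [this]; linear_combination u ^ (p - 1) * hduu
  have h5 : p ^ (-p) * μ ^ (-(p / q)) * d ^ p = μ * u ^ p := by
    rw [hu, Real.div_rpow hd0 (by positivity), Real.mul_rpow hp.le hμ.le, Real.rpow_neg hp.le,
      show -(p / q) = 1 - p by rw [hpq.div_conj_eq_sub_one]; ring, Real.rpow_sub hμ, Real.rpow_one]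
    field_simp
  have h6 := mul_le_mul_of_nonneg_left h2 (div_pos hμ hq1).le
  rw [smul_apply, smul_eq_mul, hv] at h1
  have h7 : u ^ (p - 1) * d - g y ≤ μ / (q - 1) * u ^ p := h1.trans h6
  rw [h3, h4] at h7
  rw [h5]
  linarith

end IsNonnegNear

/-! ### Consequences of reflexivity -/

theorem IsReflexive.completeSpace {X : Type*} [NormedAddCommGroup X] [NormedSpace ℝ X]
    (hX : IsReflexive X) : CompleteSpace X := by
  let e : X ≃ₗᵢ[ℝ] StrongDual ℝ (StrongDual ℝ X) :=
    LinearIsometryEquiv.ofSurjective (NormedSpace.inclusionInDoubleDualLi ℝ) hX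
  exact e.toIsometryEquiv.completeSpace

/-- Since every element of the bidual is an evaluation, Φ is determined by its values on
evaluations. This is what makes conjugates, which live on the dual, densely smooth. -/
theorem IsReflexive.dual {X : Type*} [NormedAddCommGroup X] [NormedSpace ℝ X]
    (hX : IsReflexive X) : IsReflexive (StrongDual ℝ X) := by
  intro Φ
  refine ⟨Φ.comp (NormedSpace.inclusionInDoubleDual ℝ X), ?_⟩
  ext T
  obtain ⟨x, rfl⟩ := hX T
  rfl

/-! ### The three implications for f on the ball -/

/-- The points of the ball around `x₀` at which `f` is finite. -/
def finiteBall {X : Type*} [NormedAddCommGroup X] (f : X → EReal) (x₀ : X) (δ : ℝ) : Set X :=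
  {x | x ∈ closedBall x₀ δ ∧ f x ≠ ⊤}

section

variable {X : Type*} [NormedAddCommGroup X] {f : X → EReal} {x₀ : X} {δ : ℝ}

theorem le_of_strict_min (hmin : ∀ x ∈ closedBall x₀ δ \ {x₀}, f x₀ < f x) {x : X}
    (hx : x ∈ closedBall x₀ δ) : f x₀ ≤ f x := by
  rcases eq_or_ne x x₀ with rfl | hne
  · exact le_rfl
  · exact (hmin x ⟨hx, hne⟩).le

theorem coe_toReal_of_finiteBall (hf : IsProper f) {x : X} (hx : x ∈ finiteBall f x₀ δ) :
    ((f x).toReal : EReal) = f x :=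
  EReal.coe_toReal hx.2 (hf.1 x)

/-- Lower semicontinuity bounds f z by the limit of finite bounds, so f z is itself finite and z
stays in the set. -/
theorem isSeqClosedEpi_finiteBall (hf : IsProper f) (hlsc : LowerSemicontinuous f) :
    IsSeqClosedEpi (finiteBall f x₀ δ) (fun x => (f x).toReal - (f x₀).toReal) := by
  intro y a z b hy hya hyz hab
  have hz : z ∈ closedBall x₀ δ :=
    isClosed_closedBall.mem_of_tendsto hyz (Eventually.of_forall fun n => (hy n).1)
  have hle : f z ≤ ((b + (f x₀).toReal : ℝ) : EReal) := by
    by_contra! hlt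
    obtain ⟨r, hbr, hrz⟩ := EReal.lt_iff_exists_real_btwn.1 hlt
    rw [EReal.coe_lt_coe_iff] at hbr
    obtain ⟨n, h1, h2⟩ := ((hyz.eventually (hlsc z r hrz)).and
      ((hab.add_const (f x₀).toReal).eventually (gt_mem_nhds hbr))).exists
    rw [← coe_toReal_of_finiteBall hf (hy n), gt_iff_lt, EReal.coe_lt_coe_iff] at h1
    have h3 := hya n
    dsimp only at h3 h2
    linarith
  have htop : f z ≠ ⊤ := (hle.trans_lt (EReal.coe_lt_top _)).ne
  refine ⟨⟨hz, htop⟩, ?_⟩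
  have h := hle
  rw [← EReal.coe_toReal htop (hf.1 z), EReal.coe_le_coe_iff] at h
  show (f z).toReal - (f x₀).toReal ≤ b
  linarith

variable [NormedSpace ℝ X]

/-- A strict minimizer over a ball of a proper function has a finite value. -/
theorem ne_top_of_strict_min (hf : IsProper f) (hδ : 0 < δ)
    (hmin : ∀ x ∈ closedBall x₀ δ \ {x₀}, f x₀ < f x) : f x₀ ≠ ⊤ := by
  intro htop
  obtain ⟨y, hy⟩ := hf.2
  have hne : y - x₀ ≠ 0 := fun h => hy (by rw [sub_eq_zero.1 h, htop])
  have hn : 0 < ‖y - x₀‖ := norm_pos_iff.2 hne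
  -- The point at distance δ from x₀ in the direction of y would need a value above ⊤.
  have h := hmin (x₀ + (δ / ‖y - x₀‖) • (y - x₀)) ⟨by
    rw [mem_closedBall, dist_eq_norm, add_sub_cancel_left, norm_smul, Real.norm_of_nonneg
      (by positivity), div_mul_cancel₀ _ hn.ne'], by
    simp only [Set.mem_singleton_iff, add_eq_left, smul_eq_zero, not_or]
    exact ⟨by positivity, hne⟩⟩
  rw [htop] at h
  exact not_top_lt h

theorem isNonnegNear_finiteBall (hf : IsProper f) (hδ : 0 < δ)
    (hmin : ∀ x ∈ closedBall x₀ δ \ {x₀}, f x₀ < f x) :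
    IsNonnegNear (finiteBall f x₀ δ) (fun x => (f x).toReal - (f x₀).toReal) x₀ δ where
  mem := ⟨mem_closedBall_self hδ.le, ne_top_of_strict_min hf hδ hmin⟩
  zero := sub_self _
  nonneg x hx := sub_nonneg.2 (EReal.toReal_le_toReal (le_of_strict_min hmin hx.1) (hf.1 x₀) hx.2)
  bound x hx := by simpa [dist_eq_norm] using hx.1

theorem tilt_eq_coe (hf : IsProper f) (ξ : StrongDual ℝ X) {x : X}
    (hx : x ∈ finiteBall f x₀ δ) : tilt f ξ x = (((f x).toReal - ξ x : ℝ) : EReal) := by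
  rw [EReal.coe_sub, coe_toReal_of_finiteBall hf hx, tilt]

/-- A minimizer of a tilt has finite value and beats the base point. -/
theorem mem_finiteBall_of_mem_argminOn (hf : IsProper f) (hδ : 0 < δ)
    (hmin : ∀ x ∈ closedBall x₀ δ \ {x₀}, f x₀ < f x) {ξ : StrongDual ℝ X} {x : X}
    (hx : x ∈ argminOn (closedBall x₀ δ) (tilt f ξ)) :
    x ∈ finiteBall f x₀ δ ∧ (f x).toReal - (f x₀).toReal ≤ ‖ξ‖ * ‖x - x₀‖ := by
  have h₀ := (isNonnegNear_finiteBall hf hδ hmin).mem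
  have hle := hx.2 x₀ h₀.1
  rw [tilt_eq_coe hf ξ h₀] at hle
  have hfin : x ∈ finiteBall f x₀ δ := by
    refine ⟨hx.1, fun htop => ?_⟩
    rw [tilt, htop, EReal.top_sub_coe] at hle
    exact (EReal.coe_lt_top _).not_ge hle
  rw [tilt_eq_coe hf ξ hfin, EReal.coe_le_coe_iff] at hle
  refine ⟨hfin, ?_⟩
  have h1 := (Real.le_norm_self _).trans (ξ.le_opNorm (x - x₀))
  rw [map_sub] at h1
  linarith

theorem mem_argminOn_of_finiteBall (hf : IsProper f) {ξ : StrongDual ℝ X} {x : X}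
    (hx : x ∈ finiteBall f x₀ δ)
    (h : ∀ y ∈ finiteBall f x₀ δ, (f x).toReal - ξ x ≤ (f y).toReal - ξ y) :
    x ∈ argminOn (closedBall x₀ δ) (tilt f ξ) := by
  refine ⟨hx.1, fun y hy => ?_⟩
  by_cases htop : f y = ⊤
  · rw [tilt, tilt, htop, EReal.top_sub_coe]
    exact le_top
  · rw [tilt_eq_coe hf ξ hx, tilt_eq_coe hf ξ (⟨hy, htop⟩ : y ∈ finiteBall f x₀ δ),
      EReal.coe_le_coe_iff]
    exact h y ⟨hy, htop⟩

/-- Growth and comparison with x₀ give γ d^p ≤ ‖ξ‖ d for d = ‖x - x₀‖. Cancel d and raise to the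
power q / p = 1 / (p - 1). -/
theorem GrowthCondition.tiltSubstable (hf : IsProper f) (hδ : 0 < δ)
    (hmin : ∀ x ∈ closedBall x₀ δ \ {x₀}, f x₀ < f x) {p q : ℝ} (hpq : p.HolderConjugate q)
    {γ : ℝ} (hγ : 0 < γ) (h : GrowthCondition f x₀ δ p γ) :
    TiltSubstable f x₀ δ p q (γ ^ (-(q / p))) := by
  intro ξ x hx
  have h₀ := (isNonnegNear_finiteBall hf hδ hmin).mem
  obtain ⟨hfin, hle⟩ := mem_finiteBall_of_mem_argminOn hf hδ hmin hx
  have hg := h x hx.1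
  rw [← coe_toReal_of_finiteBall hf hfin, ← coe_toReal_of_finiteBall hf h₀, ← EReal.coe_add,
    EReal.coe_le_coe_iff] at hg
  rcases (norm_nonneg (x - x₀)).eq_or_lt with h0 | hd
  · rw [← h0]; positivity
  have hqp : 0 < q / p := div_pos hpq.symm.pos hpq.pos
  have hpow : ‖x - x₀‖ ^ p = ‖x - x₀‖ ^ (p - 1) * ‖x - x₀‖ := by
    rw [← Real.rpow_add_one hd.ne']; ring_nf
  have h1 : ‖x - x₀‖ ^ (p - 1) ≤ γ⁻¹ * ‖ξ‖ := by
    rw [hpow] at hg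
    have h2 : γ * ‖x - x₀‖ ^ (p - 1) * ‖x - x₀‖ ≤ ‖ξ‖ * ‖x - x₀‖ := by linarith
    rw [inv_mul_eq_div, le_div_iff₀ hγ, mul_comm]
    exact le_of_mul_le_mul_right h2 hd
  have h2 := Real.rpow_le_rpow (by positivity) h1 hqp.le
  rw [← Real.rpow_mul hd.le, Real.mul_rpow (by positivity) (norm_nonneg _), Real.inv_rpow hγ.le,
    ← Real.rpow_neg hγ.le] at h2
  have h3 : (p - 1) * (q / p) = 1 := by
    rw [← mul_div_assoc, hpq.sub_one_mul_conj, div_self hpq.ne_zero]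
  rwa [h3, Real.rpow_one] at h2

/-- Insert the bound on ‖x - x₀‖ into f x - f x₀ ≤ ‖ξ‖ ‖x - x₀‖ and use q / p + 1 = q. -/
theorem TiltSubstable.lojasiewiczBound (hf : IsProper f) (hδ : 0 < δ)
    (hmin : ∀ x ∈ closedBall x₀ δ \ {x₀}, f x₀ < f x) {p q : ℝ} (hpq : p.HolderConjugate q)
    {κ : ℝ} (h : TiltSubstable f x₀ δ p q κ) : LojasiewiczBound f x₀ δ q κ := by
  intro ξ x hx
  have h₀ := (isNonnegNear_finiteBall hf hδ hmin).mem
  obtain ⟨hfin, hle⟩ := mem_finiteBall_of_mem_argminOn hf hδ hmin hx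
  rw [← coe_toReal_of_finiteBall hf hfin, ← coe_toReal_of_finiteBall hf h₀, ← EReal.coe_sub,
    EReal.coe_le_coe_iff]
  have h1 := mul_le_mul_of_nonneg_left (h ξ x hx) (norm_nonneg ξ)
  have hqp : 0 < q / p := div_pos hpq.symm.pos hpq.pos
  have h2 : ‖ξ‖ ^ q = ‖ξ‖ ^ (q / p) * ‖ξ‖ := by
    rw [← Real.rpow_add_one' (norm_nonneg _) (by linarith), hpq.symm.div_conj_eq_sub_one]
    ring_nf
  rw [h2]
  linarith

theorem LojasiewiczBound.growthCondition (hX : IsReflexive X) (hf : IsProper f)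
    (hlsc : LowerSemicontinuous f) (hδ : 0 < δ)
    (hmin : ∀ x ∈ closedBall x₀ δ \ {x₀}, f x₀ < f x) {p q : ℝ} (hpq : p.HolderConjugate q)
    {μ : ℝ} (hμ : 0 < μ) (h : LojasiewiczBound f x₀ δ q μ) :
    GrowthCondition f x₀ δ p (p ^ (-p) * μ ^ (-(p / q))) := by
  have := hX.completeSpace
  have hN := isNonnegNear_finiteBall hf hδ hmin
  have hstrict : ∀ x ∈ finiteBall f x₀ δ, (f x).toReal - (f x₀).toReal ≤ 0 → x = x₀ := by
    intro x hx hle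
    by_contra hne
    have hlt := hmin x ⟨hx.1, hne⟩
    rw [← coe_toReal_of_finiteBall hf hx, ← coe_toReal_of_finiteBall hf hN.mem,
      EReal.coe_lt_coe_iff] at hlt
    linarith
  have hloj : ∀ (ξ : StrongDual ℝ X), ∀ x ∈ finiteBall f x₀ δ, (∀ y ∈ finiteBall f x₀ δ,
      ξ (y - x₀) - ((f y).toReal - (f x₀).toReal) ≤
        ξ (x - x₀) - ((f x).toReal - (f x₀).toReal)) →
      (f x).toReal - (f x₀).toReal ≤ μ * ‖ξ‖ ^ q := by
    intro ξ x hx hopt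
    have h1 := h ξ x (mem_argminOn_of_finiteBall hf hx fun y hy => by
      have := hopt y hy
      rw [map_sub, map_sub] at this
      linarith)
    rwa [← coe_toReal_of_finiteBall hf hx, ← coe_toReal_of_finiteBall hf hN.mem, ← EReal.coe_sub,
      EReal.coe_le_coe_iff] at h1
  intro x hx
  by_cases htop : f x = ⊤
  · rw [htop]; exact le_top
  have hfin : x ∈ finiteBall f x₀ δ := ⟨hx, htop⟩
  have h1 := hN.rpow_le_of_conjOn_le hpq hμ (hN.conjOn_le_rpow
    (isSeqClosedEpi_finiteBall hf hlsc) hX.dual hstrict hpq.symm.lt hμ.le hloj) hfin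
  rw [← coe_toReal_of_finiteBall hf hfin, ← coe_toReal_of_finiteBall hf hN.mem, ← EReal.coe_add,
    EReal.coe_le_coe_iff]
  linarith

end

end TiltGrowth

theorem theorem1p1 {X : Type*} [NormedAddCommGroup X] [NormedSpace ℝ X]
    (hX : TiltGrowth.IsReflexive X)
    (f : X → EReal) (hf : TiltGrowth.IsProper f) (hlsc : LowerSemicontinuous f)
    (x₀ : X) (δ : ℝ) (hδ : 0 < δ)
    (hmin : ∀ x ∈ Metric.closedBall x₀ δ \ {x₀}, f x₀ < f x)
    (p q : ℝ) (hp : 1 < p) (hq : 1 < q) (hpq : p⁻¹ + q⁻¹ = 1) :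
    List.TFAE
      [∃ γ : ℝ, 0 < γ ∧ TiltGrowth.GrowthCondition f x₀ δ p γ,
       ∃ κ : ℝ, 0 < κ ∧ TiltGrowth.TiltSubstable f x₀ δ p q κ,
       ∃ μ : ℝ, 0 < μ ∧ TiltGrowth.LojasiewiczBound f x₀ δ q μ] ∧
    (∀ γ : ℝ, 0 < γ → TiltGrowth.GrowthCondition f x₀ δ p γ →
      TiltGrowth.TiltSubstable f x₀ δ p q (γ ^ (-(q / p)))) ∧
    (∀ κ : ℝ, 0 < κ → TiltGrowth.TiltSubstable f x₀ δ p q κ →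
      TiltGrowth.LojasiewiczBound f x₀ δ q κ) ∧
    (∀ μ : ℝ, 0 < μ → TiltGrowth.LojasiewiczBound f x₀ δ q μ →
      TiltGrowth.GrowthCondition f x₀ δ p (p ^ (-p) * μ ^ (-(p / q)))) := by
  have hH : p.HolderConjugate q := Real.holderConjugate_iff.2 ⟨hp, hpq⟩
  have h12 : ∀ γ : ℝ, 0 < γ → TiltGrowth.GrowthCondition f x₀ δ p γ →
      TiltGrowth.TiltSubstable f x₀ δ p q (γ ^ (-(q / p))) :=
    fun γ hγ h => h.tiltSubstable hf hδ hmin hH hγ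
  have h23 : ∀ κ : ℝ, 0 < κ → TiltGrowth.TiltSubstable f x₀ δ p q κ →
      TiltGrowth.LojasiewiczBound f x₀ δ q κ :=
    fun κ _ h => h.lojasiewiczBound hf hδ hmin hH
  have h31 : ∀ μ : ℝ, 0 < μ → TiltGrowth.LojasiewiczBound f x₀ δ q μ →
      TiltGrowth.GrowthCondition f x₀ δ p (p ^ (-p) * μ ^ (-(p / q))) :=
    fun μ hμ h => h.growthCondition hX hf hlsc hδ hmin hH hμ
  refine ⟨?_, h12, h23, h31⟩
  tfae_have 1 → 2 := fun ⟨γ, hγ, h⟩ => ⟨_, Real.rpow_pos_of_pos hγ _, h12 γ hγ h⟩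
  tfae_have 2 → 3 := fun ⟨κ, hκ, h⟩ => ⟨κ, hκ, h23 κ hκ h⟩
  tfae_have 3 → 1 := fun ⟨μ, hμ, h⟩ =>
    ⟨_, mul_pos (Real.rpow_pos_of_pos (by linarith) _) (Real.rpow_pos_of_pos hμ _), h31 μ hμ h⟩
  tfae_finish
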